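/- All graphs are finite and simple. The Euler genus of the sphere with $h$ handles is $2h$, that of the sphere with $c$ cross-caps is $c$, and the Euler genus of a graph is the minimum Euler genus of a surface in which it embeds. A sequence $v_1,\dots,v_s$ of distinct vertices of a graph is called ordered if $\bigl|N[v_i]\cap\bigcup_{j<i}N[v_j]\bigr|\le 2$ for each $i\in\{1,\dots,s\}$, where $N[v]=N(v)\cup\{v\}$. Let $f_g(s)$ be the least integer $b\ge 0$ such that, for every bipartite graph $G$ of Euler genus at most $g$ and every bipartition $(A,B)$ of $G$ with $|B|>b$ in which every vertex of $B$ has degree at most $4$, the set $B$ contains an ordered sequence of $s$ vertices. Lemma 7. Let $g\ge 1$. Then $f_g(2)$ exists and $f_g(2)=2g+2$. Moreover: (1) if $G$ is a bipartite graph of Euler genus at most $g$ with bipartition $(A,B)$, and $S\subseteq B$ is a set of at least $2g+3$ vertices each of degree at most $4$ in $G$, then some two distinct vertices of $S$ have at most two common neighbours; (2) this is tight: $K_{3,2g+2}$ has Euler genus exactly $g$, and any two distinct vertices of its colour class of size $2g+2$ have exactly three common neighbours. -/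

import Mathlib

/-- A cell decomposition of a closed connected surface, presented by its flags
(mutually incident triples vertex - edge - face, one for each triangle of the barycentric
subdivision).  `t0`, `t1`, `t2` send a flag to the unique other flag that differs from it only
in the vertex, only in the edge, only in the face, respectively.  The surface is the union of the
triangles, where a flag is glued to its image under each `ti` along the side opposite to the
corner of that index.  Orientable and non-orientable surfaces are both allowed. -/
structure CellSurface where
  /-- the flags -/
  Flag : Type
  finite_flag : Finite Flag
  nonempty_flag : Nonempty Flag
  /-- change the vertex -/
  t0 : Flag → Flag
  /-- change the edge -/
  t1 : Flag → Flag
  /-- change the face -/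
  t2 : Flag → Flag
  t0_invol : Function.Involutive t0
  t1_invol : Function.Involutive t1
  t2_invol : Function.Involutive t2
  /-- no fixed points: the surface has no boundary -/
  t0_ne : ∀ x, t0 x ≠ x
  t1_ne : ∀ x, t1 x ≠ x
  t2_ne : ∀ x, t2 x ≠ x
  /-- every edge has two ends and two sides, hence exactly four flags -/
  t0_t2 : ∀ x, t0 (t2 x) = t2 (t0 x)
  t0_t2_ne : ∀ x, t0 (t2 x) ≠ x
  /-- the surface is connected -/
  connected : ∀ x y, Relation.EqvGen (fun a b => b = t0 a ∨ b = t1 a ∨ b = t2 a) x y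

namespace CellSurface

/-- The vertices: classes of flags under changes of edge and face. -/
def Vertex (M : CellSurface) : Type := Quot (fun x y : M.Flag => y = M.t1 x ∨ y = M.t2 x)

/-- The edges: classes of flags under changes of vertex and face. -/
def Edge (M : CellSurface) : Type := Quot (fun x y : M.Flag => y = M.t0 x ∨ y = M.t2 x)

/-- The faces: classes of flags under changes of vertex and edge. -/
def Face (M : CellSurface) : Type := Quot (fun x y : M.Flag => y = M.t0 x ∨ y = M.t1 x)

/-- The vertex of a flag. -/
def vertexOf (M : CellSurface) (x : M.Flag) : M.Vertex := Quot.mk _ x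

/-- The Euler characteristic `V - E + F`. -/
noncomputable def eulerChar (M : CellSurface) : ℤ :=
  (Nat.card M.Vertex : ℤ) - Nat.card M.Edge + Nat.card M.Face

/-- The Euler genus `2 - χ` of the surface: it is `2h` for the sphere with `h` handles and `c` for
the sphere with `c` cross-caps. -/
noncomputable def eulerGenus (M : CellSurface) : ℤ := 2 - M.eulerChar

/-- Two vertices are joined by an edge of the cell decomposition. -/
def Joined (M : CellSurface) (p q : M.Vertex) : Prop :=
  ∃ x : M.Flag, M.vertexOf x = p ∧ M.vertexOf (M.t0 x) = q

end CellSurface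

namespace SimpleGraph

/-- `G` embeds in some closed connected surface of Euler genus `g`: it is a subgraph of the
1-skeleton of some cell decomposition of such a surface.  The decomposition may have further
vertices and edges, so `G` may be disconnected and its embedding need not be 2-cell. -/
def EmbedsInEulerGenus {V : Type*} (G : SimpleGraph V) (g : ℕ) : Prop :=
  ∃ M : CellSurface, M.eulerGenus = g ∧
    ∃ φ : V → M.Vertex, Function.Injective φ ∧ ∀ u v, G.Adj u v → M.Joined (φ u) (φ v)

/-- The Euler genus of a graph: the minimum Euler genus of a surface in which it embeds
(`⊤` if there is none). -/
noncomputable def eulerGenus {V : Type*} (G : SimpleGraph V) : ℕ∞ :=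
  ⨅ (g : ℕ) (_ : G.EmbedsInEulerGenus g), (g : ℕ∞)

/-- The closed neighbourhood `N[v] = N(v) ∪ {v}`. -/
def closedNbhd {V : Type*} (G : SimpleGraph V) (v : V) : Set V := G.neighborSet v ∪ {v}

/-- `v` is an ordered sequence of `s` (distinct) vertices: each `N[v i]` meets the union of the
earlier `N[v j]` in at most two vertices. -/
def IsOrderedSeq {V : Type*} (G : SimpleGraph V) {s : ℕ} (v : Fin s → V) : Prop :=
  Function.Injective v ∧
    ∀ i, (G.closedNbhd (v i) ∩ ⋃ j : Fin s, ⋃ _ : j < i, G.closedNbhd (v j)).encard ≤ 2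

/-- `(A, B)` is a bipartition of `G`. -/
def IsBipartition {V : Type*} (G : SimpleGraph V) (A B : Set V) : Prop :=
  G.IsBipartiteWith A B ∧ A ∪ B = Set.univ

end SimpleGraph

/-- For every finite bipartite graph `G` of Euler genus at most `g` with a bipartition `(A, B)` such
that `|B| > b` and all vertices in `B` have degree at most 4, `B` contains an ordered sequence of
`s` vertices. -/
def ForcesOrderedSeq (g s b : ℕ) : Prop :=
  ∀ (V : Type) [Finite V] (G : SimpleGraph V) (A B : Set V),
    G.eulerGenus ≤ g → G.IsBipartition A B → b < B.ncard →
    (∀ v ∈ B, (G.neighborSet v).encard ≤ 4) →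
    ∃ v : Fin s → V, (∀ i, v i ∈ B) ∧ G.IsOrderedSeq v

/-- The number `f_g(s)`: the least `b` with `ForcesOrderedSeq g s b`. -/
noncomputable def orderedNumber (g s : ℕ) : ℕ := sInf {b : ℕ | ForcesOrderedSeq g s b}

/-! Upper bound. Euler's formula limits a bipartite graph with parts P, Q in a surface of Euler
genus k to 2(|P| + |Q|) - 4 + 2k edges (`card_bipartite_edges_le`). If any two of n = |S|
neighbourhoods of size at most 4 share three elements, then either all contain one triple, or all
have four elements in one set of size at most 5 (`exists_triple_or_exists_quintuple`). Counting
edges to that set gives n ≤ 2k + 2 or n ≤ k + 3, and for k ≤ g with g ≥ 1 both are below 2g + 3.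

The edge bound is proved by linear algebra over `ZMod 2`, with no deformation to a 2-cell embedding.
Vertex coboundaries are orthogonal to face boundaries, so the ranks of these two maps, restricted to
the edges outside the subgraph, add up to at most the number of such edges. This is Euler's
inequality with regions in place of faces (`eulerChar_le_card_region`). Each region is bounded by at
least four edges, and each edge bounds at most two regions.

Tightness. The edge bound gives genus at least g for K_{3,2g+2}. For the converse, take a cubic
graph on 2g + 2 vertices with three perfect matchings, any two forming a Hamiltonian cycle; repeated
truncation of the theta graph gives one. Using these cycles as the rotations at the three vertices
of the small class gives a quadrangulation of Euler genus g by K_{3,2g+2}. For two vertices in the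
same class, closed neighbourhoods meet exactly in the common neighbours, so this graph has no
ordered pair in its large class. -/

namespace CellSurface

/-! ### Flags, edges and connectedness -/

variable (M : CellSurface)

instance : Finite M.Flag := M.finite_flag
instance : Nonempty M.Flag := M.nonempty_flag
instance : Finite M.Vertex := inferInstanceAs (Finite (Quot _))
instance : Finite M.Edge := inferInstanceAs (Finite (Quot _))
instance : Finite M.Face := inferInstanceAs (Finite (Quot _))

/-- The edge of a flag. -/
def edgeOf (x : M.Flag) : M.Edge := Quot.mk _ x

/-- The face of a flag. -/
def faceOf (x : M.Flag) : M.Face := Quot.mk _ x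

@[simp] lemma vertexOf_t1 (x : M.Flag) : M.vertexOf (M.t1 x) = M.vertexOf x := by
  refine Eq.symm (Quot.sound ?_); exact Or.inl rfl
@[simp] lemma vertexOf_t2 (x : M.Flag) : M.vertexOf (M.t2 x) = M.vertexOf x := by
  refine Eq.symm (Quot.sound ?_); exact Or.inr rfl
@[simp] lemma edgeOf_t0 (x : M.Flag) : M.edgeOf (M.t0 x) = M.edgeOf x := by
  refine Eq.symm (Quot.sound ?_); exact Or.inl rfl
@[simp] lemma edgeOf_t2 (x : M.Flag) : M.edgeOf (M.t2 x) = M.edgeOf x := by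
  refine Eq.symm (Quot.sound ?_); exact Or.inr rfl
@[simp] lemma faceOf_t0 (x : M.Flag) : M.faceOf (M.t0 x) = M.faceOf x := by
  refine Eq.symm (Quot.sound ?_); exact Or.inl rfl
@[simp] lemma faceOf_t1 (x : M.Flag) : M.faceOf (M.t1 x) = M.faceOf x := by
  refine Eq.symm (Quot.sound ?_); exact Or.inr rfl

lemma vertexOf_surj (p : M.Vertex) : ∃ x, M.vertexOf x = p := Quot.exists_rep p
lemma edgeOf_surj (e : M.Edge) : ∃ x, M.edgeOf x = e := Quot.exists_rep e
lemma faceOf_surj (f : M.Face) : ∃ x, M.faceOf x = f := Quot.exists_rep f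

@[simp] lemma t0_t0 (x : M.Flag) : M.t0 (M.t0 x) = x := M.t0_invol x
@[simp] lemma t2_t2 (x : M.Flag) : M.t2 (M.t2 x) = x := M.t2_invol x

lemma Joined.symm {M : CellSurface} {p q : M.Vertex} (h : M.Joined p q) : M.Joined q p := by
  obtain ⟨x, hp, hq⟩ := h
  exact ⟨M.t0 x, hq, by simpa using hp⟩

/-- Connectedness of the surface enters the proof in this form. -/
lemma const_of_invariant {α : Type*} (f : M.Flag → α) (h0 : ∀ x, f (M.t0 x) = f x)
    (h1 : ∀ x, f (M.t1 x) = f x) (h2 : ∀ x, f (M.t2 x) = f x) (x y : M.Flag) : f x = f y := by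
  induction M.connected x y with
  | rel a b h => rcases h with rfl | rfl | rfl <;> simp [h0, h1, h2]
  | refl => rfl
  | symm _ _ _ ih => exact ih.symm
  | trans _ _ _ _ _ ih ih' => exact ih.trans ih'

/-- Since `t0` and `t2` are commuting involutions, the four listed flags are closed under both. -/
lemma edgeOf_eq_iff (x y : M.Flag) :
    M.edgeOf y = M.edgeOf x ↔ y = x ∨ y = M.t0 x ∨ y = M.t2 x ∨ y = M.t0 (M.t2 x) := by
  constructor
  · intro h
    have h' := Quot.eqvGen_exact h
    clear h
    have key : ∀ a b : M.Flag, Relation.EqvGen (fun x y => y = M.t0 x ∨ y = M.t2 x) a b →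
        ((a = x ∨ a = M.t0 x ∨ a = M.t2 x ∨ a = M.t0 (M.t2 x)) ↔
          (b = x ∨ b = M.t0 x ∨ b = M.t2 x ∨ b = M.t0 (M.t2 x))) := by
      intro a b hab
      induction hab with
      | rel a b h =>
        rcases h with rfl | rfl
        · have e1 : ∀ u, M.t0 a = u ↔ a = M.t0 u := fun u =>
            ⟨fun h => by simp [← h], fun h => by simp [h]⟩
          simp only [e1, t0_t0]
          tauto
        · have e1 : ∀ u, M.t2 a = u ↔ a = M.t2 u := fun u =>
            ⟨fun h => by simp [← h], fun h => by simp [h]⟩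
          simp only [e1, t2_t2, M.t0_t2, t2_t2]
          tauto
      | refl => rfl
      | symm _ _ _ ih => exact ih.symm
      | trans _ _ _ _ _ ih ih' => exact ih.trans ih'
    exact (key _ _ h').2 (Or.inl rfl)
  · rintro (rfl | rfl | rfl | rfl) <;> simp

/-- The unordered pair of ends of an edge. -/
def ends (e : M.Edge) : Sym2 M.Vertex :=
  Quot.lift (fun x => s(M.vertexOf x, M.vertexOf (M.t0 x)))
    (by rintro x y (rfl | rfl)
        · simp [Sym2.eq_swap]
        · simp [M.t0_t2]) e

/-! ### Orthogonality of coboundaries and boundaries modulo 2 -/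

/-- The coboundary of a vertex cochain modulo 2. -/
def coboundary : (M.Vertex → ZMod 2) →ₗ[ZMod 2] (M.Edge → ZMod 2) where
  toFun p := Quot.lift (fun x => p (M.vertexOf x) + p (M.vertexOf (M.t0 x)))
    (by rintro x y (rfl | rfl)
        · simp [add_comm]
        · simp [M.t0_t2])
  map_add' p q := by
    ext e; obtain ⟨x, rfl⟩ := Quot.exists_rep e
    exact add_add_add_comm _ _ _ _
  map_smul' c p := by
    ext e; obtain ⟨x, rfl⟩ := Quot.exists_rep e
    exact (mul_add _ _ _).symm

/-- The boundary of a face chain modulo 2. -/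
def boundary : (M.Face → ZMod 2) →ₗ[ZMod 2] (M.Edge → ZMod 2) where
  toFun f := Quot.lift (fun x => f (M.faceOf x) + f (M.faceOf (M.t2 x)))
    (by rintro x y (rfl | rfl)
        · simp [← M.t0_t2]
        · simp [add_comm])
  map_add' p q := by
    ext e; obtain ⟨x, rfl⟩ := Quot.exists_rep e
    exact add_add_add_comm _ _ _ _
  map_smul' c p := by
    ext e; obtain ⟨x, rfl⟩ := Quot.exists_rep e
    exact (mul_add _ _ _).symm

lemma coboundary_edgeOf (p : M.Vertex → ZMod 2) (x : M.Flag) :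
    M.coboundary p (M.edgeOf x) = p (M.vertexOf x) + p (M.vertexOf (M.t0 x)) := rfl

lemma boundary_edgeOf (f : M.Face → ZMod 2) (x : M.Flag) :
    M.boundary f (M.edgeOf x) = f (M.faceOf x) + f (M.faceOf (M.t2 x)) := rfl

/-- Expanding the product at an edge gives one term p(vertex) f(face) for each of its four flags, so
the sum runs over all flags. There `t1` pairs equal terms, which cancel modulo 2. -/
lemma sum_coboundary_mul_boundary [Fintype M.Edge] (p : M.Vertex → ZMod 2)
    (f : M.Face → ZMod 2) : ∑ e, M.coboundary p e * M.boundary f e = 0 := by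
  classical
  have : Fintype M.Flag := Fintype.ofFinite _
  have h1 : ∑ x : M.Flag, p (M.vertexOf x) * f (M.faceOf x) = 0 := by
    refine Finset.sum_involution (fun x _ => M.t1 x) (fun x _ => ?_) (fun x _ _ => M.t1_ne x)
      (fun x _ => Finset.mem_univ _) (fun x _ => M.t1_invol x)
    simp [CharTwo.add_self_eq_zero]
  rw [← h1, ← Finset.sum_fiberwise_of_maps_to (g := M.edgeOf) (t := Finset.univ) (by simp)]
  refine Finset.sum_congr rfl fun e _ => ?_
  obtain ⟨x, rfl⟩ := M.edgeOf_surj e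
  have hfib : (Finset.univ.filter fun y => M.edgeOf y = M.edgeOf x) =
      {x, M.t0 x, M.t2 x, M.t0 (M.t2 x)} := by
    ext y; simp [edgeOf_eq_iff]
  have n1 := M.t0_ne
  have n2 := M.t2_ne
  have n3 := M.t0_t2_ne
  rw [hfib, Finset.sum_insert, Finset.sum_insert, Finset.sum_insert, Finset.sum_singleton,
    coboundary_edgeOf, boundary_edgeOf]
  · simp only [faceOf_t0, vertexOf_t2, M.t0_t2 x]
    rw [← M.t0_t2 x, faceOf_t0]; ring
  · simpa using (n1 _).symm
  · simp only [Finset.mem_insert, Finset.mem_singleton, not_or]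
    refine ⟨fun h => n3 x ?_, fun h => n2 x ?_⟩
    · rw [← h, t0_t0]
    · exact (M.t0_invol.injective h).symm
  · simp only [Finset.mem_insert, Finset.mem_singleton, not_or]
    exact ⟨(n1 x).symm, (n2 x).symm, (n3 x).symm⟩

/-! ### Euler's inequality for regions -/

/-- Two faces are in the same region if they can be linked by crossing edges outside `D`. -/
def Region (D : Set M.Edge) : Type :=
  Quot fun f f' : M.Face => ∃ x, M.edgeOf x ∉ D ∧ f = M.faceOf x ∧ f' = M.faceOf (M.t2 x)

instance (D : Set M.Edge) : Finite (M.Region D) := inferInstanceAs (Finite (Quot _))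

/-- The region of a face. -/
def regionOf (D : Set M.Edge) (f : M.Face) : M.Region D := Quot.mk _ f

lemma regionOf_t2 {D : Set M.Edge} {x : M.Flag} (hx : M.edgeOf x ∉ D) :
    M.regionOf D (M.faceOf (M.t2 x)) = M.regionOf D (M.faceOf x) :=
  (Quot.sound ⟨x, hx, rfl, rfl⟩).symm

/-- Euler's inequality for the regions of a subgraph with vertex set `W` and edge set `D`. -/
lemma eulerChar_le_card_region (W : Set M.Vertex) (hW : W.Nonempty) (D : Set M.Edge)
    (hDW : ∀ x, M.edgeOf x ∈ D → M.vertexOf x ∈ W) :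
    M.eulerChar ≤ Nat.card W - Nat.card D + Nat.card (M.Region D) := by
  classical
  have : Fintype M.Vertex := Fintype.ofFinite _
  have : Fintype M.Edge := Fintype.ofFinite _
  have : Fintype M.Face := Fintype.ofFinite _
  have : Fintype (M.Region D) := Fintype.ofFinite _
  -- Below, `a` is the coboundary on cochains vanishing on `W` and `b` the boundary on face chains,
  -- both read off outside `D`. The ranks are |Wᶜ| and at least F - #regions; since aᵀb = 0, they
  -- sum to at most |Dᶜ|.
  let ext0 : ((Wᶜ : Set M.Vertex) → ZMod 2) →ₗ[ZMod 2] (M.Vertex → ZMod 2) :=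
    { toFun := fun p v => if h : v ∈ Wᶜ then p ⟨v, h⟩ else 0
      map_add' := fun p q => by ext v; by_cases h : v ∈ W <;> simp [h]
      map_smul' := fun c p => by ext v; by_cases h : v ∈ W <;> simp [h] }
  have ext0_mem : ∀ p v, v ∈ W → ext0 p v = 0 := fun p v h => by simp [ext0, h]
  have ext0_not : ∀ p (v : (Wᶜ : Set M.Vertex)), ext0 p v = p v := fun p v => by
    have : (v : M.Vertex) ∉ W := v.2
    simp [ext0, this]
  let res : (M.Edge → ZMod 2) →ₗ[ZMod 2] ((Dᶜ : Set M.Edge) → ZMod 2) :=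
    LinearMap.funLeft _ _ Subtype.val
  let a := res ∘ₗ M.coboundary ∘ₗ ext0
  let b := res ∘ₗ M.boundary
  have cob0 : ∀ p e, e ∈ D → M.coboundary (ext0 p) e = 0 := by
    intro p e he
    obtain ⟨x, rfl⟩ := M.edgeOf_surj e
    rw [coboundary_edgeOf, ext0_mem _ _ (hDW _ he), ext0_mem _ _ (hDW _ (by simpa using he)),
      add_zero]
  -- A cochain in the kernel is constant on the connected surface, and it vanishes at a point of the
  -- nonempty set `W`.
  have ha : Function.Injective a := by
    rw [injective_iff_map_eq_zero]
    intro p hp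
    have h0 : ∀ x, M.coboundary (ext0 p) (M.edgeOf x) = 0 := by
      intro x
      by_cases hx : M.edgeOf x ∈ D
      · exact cob0 _ _ hx
      · exact congrFun hp ⟨_, hx⟩
    have hc := M.const_of_invariant (fun x => ext0 p (M.vertexOf x))
      (fun x => (CharTwo.add_eq_zero.1 (h0 x)).symm) (by simp) (by simp)
    obtain ⟨w, hw⟩ := hW
    obtain ⟨y, rfl⟩ := M.vertexOf_surj w
    ext v
    obtain ⟨x, hx⟩ := M.vertexOf_surj v
    have := hc x y
    simp only [ext0_mem _ _ hw, hx, ext0_not] at this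
    simpa using this
  -- The edges in `D` contribute nothing to the orthogonality relation, because the coboundaries
  -- vanish there.
  have hmul : (LinearMap.toMatrix' a).transpose * LinearMap.toMatrix' b = 0 := by
    ext p f
    rw [Matrix.mul_apply, Matrix.zero_apply,
      ← M.sum_coboundary_mul_boundary (ext0 (Pi.single p 1)) (Pi.single f 1)]
    simp only [Matrix.transpose_apply, LinearMap.toMatrix'_apply]
    refine Finset.sum_bij_ne_zero (fun e _ _ => e.1) (by simp) (fun _ _ _ _ _ _ h => Subtype.ext h)
      (fun e _ he => ⟨⟨e, fun h => he (by rw [cob0 _ _ h, zero_mul])⟩, by simp, ?_, rfl⟩) ?_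
    · exact he
    · intro e _ _; rfl
  have hrank := Matrix.rank_add_rank_le_card_of_mul_eq_zero hmul
  rw [Matrix.rank_transpose] at hrank
  have hra : (LinearMap.toMatrix' a).rank = Fintype.card (Wᶜ : Set M.Vertex) := by
    rw [Matrix.rank, ← Matrix.toLin'_apply', Matrix.toLin'_toMatrix',
      LinearMap.finrank_range_of_inj ha, Module.finrank_fintype_fun_eq_card]
  have hrb : Fintype.card M.Face ≤
      (LinearMap.toMatrix' b).rank + Fintype.card (M.Region D) := by
    rw [Matrix.rank, ← Matrix.toLin'_apply', Matrix.toLin'_toMatrix',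
      ← Module.finrank_fintype_fun_eq_card (ZMod 2) (η := M.Face), ← b.finrank_range_add_finrank_ker,
      ← Module.finrank_fintype_fun_eq_card (ZMod 2) (η := M.Region D)]
    -- A face chain without boundary outside `D` is constant on each region.
    have hle : LinearMap.ker b ≤
        LinearMap.range (LinearMap.funLeft (ZMod 2) (ZMod 2) (M.regionOf D)) := by
      intro f hf
      refine ⟨Quot.lift f ?_, rfl⟩
      rintro _ _ ⟨x, hx, rfl, rfl⟩
      exact CharTwo.add_eq_zero.1 (congrFun (LinearMap.mem_ker.1 hf) ⟨_, hx⟩)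
    have := Submodule.finrank_mono hle
    have := LinearMap.finrank_range_le (LinearMap.funLeft (ZMod 2) (ZMod 2) (M.regionOf D))
    omega
  have hWc := Fintype.card_compl_set W
  have hDc := Fintype.card_compl_set D
  have hW' := set_fintype_card_le_univ W
  have hD' := set_fintype_card_le_univ D
  simp only [eulerChar, Nat.card_eq_fintype_card]
  omega

end CellSurface

/-! ### The edge bound for bipartite graphs in a surface -/

lemma exists_ne_of_sum_eq_zero {α R : Type*} [Fintype α] [AddCommMonoid R] (f : α → R) (a : α)
    (hs : ∑ x, f x = 0) (ha : f a ≠ 0) : ∃ b, b ≠ a ∧ f b ≠ 0 := by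
  by_contra! hc
  exact ha (by rw [← hs, Finset.sum_eq_single a (fun b _ hb => hc b hb) (by simp)])

/-- A nonzero element of the cycle space of a complete bipartite graph has at least four edges. -/
lemma four_le_card_support_of_sum_eq_zero {P Q : Type*} [Fintype P] [Fintype Q]
    (h : P × Q → ZMod 2) (hP : ∀ p, ∑ q, h (p, q) = 0) (hQ : ∀ q, ∑ p, h (p, q) = 0)
    (h0 : ∃ d, h d ≠ 0) : 4 ≤ (Finset.univ.filter fun d => h d ≠ 0).card := by
  classical
  -- All degrees in the support are even, so the edge pq continues at both ends, to pq' and p'q, and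
  -- pq' continues to p''q'. These four edges are distinct even if p' = p''.
  obtain ⟨⟨p, q⟩, h1⟩ := h0
  obtain ⟨q', hq', h2⟩ := exists_ne_of_sum_eq_zero (fun q => h (p, q)) q (hP p) h1
  obtain ⟨p', hp', h3⟩ := exists_ne_of_sum_eq_zero (fun p : P => h (p, q)) p (hQ q) h1
  obtain ⟨p'', hp'', h4⟩ := exists_ne_of_sum_eq_zero (fun p : P => h (p, q')) p (hQ q') h2
  have : ({(p, q), (p, q'), (p', q), (p'', q')} : Finset (P × Q)).card = 4 := by
    rw [Finset.card_insert_of_notMem, Finset.card_insert_of_notMem, Finset.card_insert_of_notMem,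
      Finset.card_singleton] <;> simp [hq', hq'.symm, hp'.symm, hp''.symm]
  rw [← this]
  refine Finset.card_le_card fun d hd => ?_
  simp only [Finset.mem_insert, Finset.mem_singleton] at hd
  rcases hd with rfl | rfl | rfl | rfl <;> simpa

namespace CellSurface

/-- Euler's inequality for bipartite graphs: a set `D` of edges between disjoint vertex sets
`P` and `Q` satisfies `|D| ≤ 2 (|P| + |Q|) - 4 + 2 g`. -/
theorem card_bipartite_edges_le (M : CellSurface) {P Q : Type*} [Fintype P] [Fintype Q]
    (φ : P ⊕ Q → M.Vertex) (hφ : Function.Injective φ) (D : Finset (P × Q)) (hD : 2 ≤ D.card)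
    (hJ : ∀ d ∈ D, M.Joined (φ (Sum.inl d.1)) (φ (Sum.inr d.2))) :
    (D.card : ℤ) ≤ 2 * (Fintype.card P + Fintype.card Q) - 4 + 2 * M.eulerGenus := by
  classical
  have : Fintype M.Edge := Fintype.ofFinite _
  choose x hx1 hx2 using fun d : D => hJ d.1 d.2
  have hends : ∀ d : D, M.ends (M.edgeOf (x d)) = s(φ (Sum.inl d.1.1), φ (Sum.inr d.1.2)) :=
    fun d => by rw [← hx1, ← hx2]; rfl
  have hinj : Function.Injective fun d => M.edgeOf (x d) := by
    intro d d' h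
    have h' := congrArg M.ends h
    simp only [hends, Sym2.eq_iff, hφ.eq_iff] at h'
    simp only [Sum.inl.injEq, Sum.inr.injEq, reduceCtorEq, and_self, or_false] at h'
    exact Subtype.ext (Prod.ext h'.1 h'.2)
  set E : Set M.Edge := Set.range fun d => M.edgeOf (x d) with hE
  have : Fintype (M.Region E) := Fintype.ofFinite _
  obtain ⟨d₀, hd₀⟩ : D.Nonempty := Finset.card_pos.1 (by omega)
  have hchi := M.eulerChar_le_card_region (Set.range φ) ⟨φ (Sum.inl d₀.1), by simp⟩ E (by
    rintro y ⟨d, hd⟩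
    have h1 : M.vertexOf y ∈ M.ends (M.edgeOf y) := Sym2.mem_mk_left _ _
    simp only at hd
    rw [← hd, hends, Sym2.mem_iff] at h1
    rcases h1 with h1 | h1 <;> simp [h1])
  have hcE : Nat.card E = D.card := by
    rw [Nat.card_range_of_injective hinj]; simp
  have hcV : Nat.card (Set.range φ) = Fintype.card P + Fintype.card Q := by
    rw [Nat.card_range_of_injective hφ]; simp
  -- Double counting of pairs of a region and an edge on its boundary: at least four per region, at
  -- most two per edge.
  have hreg : Fintype.card (M.Region E) * 4 ≤ D.card * 2 := by
    by_cases hr : Fintype.card (M.Region E) ≤ 1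
    -- A single region need not have any boundary; here 2 ≤ |D| suffices.
    · omega
    have hr' : Nontrivial (M.Region E) := Fintype.one_lt_card_iff_nontrivial.1 (by omega)
    let ind : M.Region E → M.Face → ZMod 2 := fun R f => if M.regionOf E f = R then 1 else 0
    have hoff : ∀ R e, e ∉ E → M.boundary (ind R) e = 0 := by
      intro R e he
      obtain ⟨y, rfl⟩ := M.edgeOf_surj e
      simp only [boundary_edgeOf, ind, M.regionOf_t2 he]
      exact CharTwo.add_self_eq_zero _
    have hsides : ∀ R ∈ (Finset.univ : Finset (M.Region E)),
        4 ≤ (Finset.bipartiteAbove (fun R (d : D) => M.boundary (ind R) (M.edgeOf (x d)) ≠ 0)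
          Finset.univ R).card := by
      intro R _
      let h : P × Q → ZMod 2 := fun d =>
        if hd : d ∈ D then M.boundary (ind R) (M.edgeOf (x ⟨d, hd⟩)) else 0
      have hh : ∀ d : D, h d = M.boundary (ind R) (M.edgeOf (x d)) := fun d => by simp [h]
      -- The boundary of a region is a cycle: taking for p the indicator of one vertex says that its
      -- degree is even.
      have hsum : ∀ p : M.Vertex → ZMod 2,
          ∑ d, (p (φ (Sum.inl d.1)) + p (φ (Sum.inr d.2))) * h d = 0 := by
        intro p
        rw [← M.sum_coboundary_mul_boundary p (ind R)]
        symm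
        have e1 : ∑ e, M.coboundary p e * M.boundary (ind R) e =
            ∑ d : D, M.coboundary p (M.edgeOf (x d)) * M.boundary (ind R) (M.edgeOf (x d)) := by
          symm
          rw [← Finset.sum_image (s := Finset.univ) (g := fun d => M.edgeOf (x d))
            (f := fun e => M.coboundary p e * M.boundary (ind R) e) hinj.injOn]
          refine Finset.sum_subset (Finset.subset_univ _) fun e _ he => ?_
          rw [hoff R e (by simpa [hE] using he), mul_zero]
        rw [e1, ← Finset.sum_subset (Finset.subset_univ D) (fun d _ hd => by simp [h, hd]),
          ← Finset.sum_coe_sort D]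
        refine Finset.sum_congr rfl fun d _ => ?_
        rw [coboundary_edgeOf, hx1, hx2, hh]
      have h4 := four_le_card_support_of_sum_eq_zero h (fun p => ?_) (fun q => ?_) ?_
      · refine h4.trans ?_
        rw [← Finset.card_map (Function.Embedding.subtype _)]
        refine Finset.card_le_card fun d hd => ?_
        have hd' : h d ≠ 0 := by simpa using hd
        have hdD : d ∈ D := by by_contra hc; simp [h, hc] at hd'
        rw [Finset.mem_map]
        exact ⟨⟨d, hdD⟩, by simpa [Finset.bipartiteAbove, ← hh] using hd', rfl⟩
      · have := hsum (Pi.single (φ (Sum.inl p)) 1)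
        simp only [Pi.single_apply, hφ.eq_iff, Fintype.sum_prod_type, Sum.inl.injEq, reduceCtorEq,
          if_false, add_zero, ite_mul, one_mul, zero_mul] at this
        rw [Finset.sum_comm] at this
        simpa using this
      · have := hsum (Pi.single (φ (Sum.inr q)) 1)
        simp only [Pi.single_apply, hφ.eq_iff, Fintype.sum_prod_type, Sum.inr.injEq, reduceCtorEq,
          if_false, zero_add, ite_mul, one_mul, zero_mul] at this
        simpa using this
      -- If the boundary vanished, the indicator of `R` would be constant on the connected surface,
      -- yet there is a second region.
      · by_contra! hc
        have h0 : ∀ y, M.boundary (ind R) (M.edgeOf y) = 0 := by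
          intro y
          by_cases hy : M.edgeOf y ∈ E
          · obtain ⟨d, hd⟩ := hy
            rw [← hd, ← hh, hc]
          · exact hoff R _ hy
        have hconst := M.const_of_invariant (fun y => ind R (M.faceOf y)) (by simp) (by simp)
          (fun y => (CharTwo.add_eq_zero.1 (h0 y)).symm)
        obtain ⟨R', hR'⟩ := exists_ne R
        obtain ⟨f, rfl⟩ := Quot.exists_rep R
        obtain ⟨f', rfl⟩ := Quot.exists_rep R'
        obtain ⟨y, rfl⟩ := M.faceOf_surj f
        obtain ⟨y', rfl⟩ := M.faceOf_surj f'
        have h1 : ind (Quot.mk _ (M.faceOf y)) (M.faceOf y) = 1 := if_pos rfl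
        have h2 : ind (Quot.mk _ (M.faceOf y)) (M.faceOf y') = 0 := if_neg hR'
        have := hconst y y'
        simp only [h1, h2] at this
        exact one_ne_zero this
    have := Finset.card_mul_le_card_mul _ hsides (n := 2) (t := Finset.univ) (by
      intro d _
      refine (Finset.card_le_card (t := {M.regionOf E (M.faceOf (x d)),
        M.regionOf E (M.faceOf (M.t2 (x d)))}) fun R hR => ?_).trans Finset.card_le_two
      have hR' := (Finset.mem_filter.1 hR).2
      simp only [boundary_edgeOf, ind] at hR'
      simp only [Finset.mem_insert, Finset.mem_singleton]
      by_contra! hc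
      simp [hc.1.symm, hc.2.symm] at hR')
    simpa using this
  rw [hcE, hcV, Nat.card_eq_fintype_card] at hchi
  push_cast at hchi
  rw [eulerGenus]
  omega

end CellSurface

/-! ### Families of small sets with large pairwise intersections -/

/-- If finitely many sets with at most four elements pairwise share three elements, then they all
contain a common triple, or all of them have four elements in a common set of size at most 5. -/
lemma exists_triple_or_exists_quintuple {α ι : Type*} [DecidableEq α] (S : Finset ι)
    (hS : 2 ≤ S.card) (N : ι → Finset α) (h4 : ∀ i ∈ S, (N i).card ≤ 4)
    (h3 : ∀ i ∈ S, ∀ j ∈ S, i ≠ j → 3 ≤ (N i ∩ N j).card) :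
    (∃ T : Finset α, T.card = 3 ∧ ∀ i ∈ S, T ⊆ N i) ∨
      ∃ X : Finset α, X.card ≤ 5 ∧ ∀ i ∈ S, 4 ≤ (N i ∩ X).card := by
  by_cases hall : ∀ i ∈ S, ∀ j ∈ S, N i = N j
  · left
    obtain ⟨i, hi, j, hj, hij⟩ := Finset.one_lt_card.1 hS
    obtain ⟨T, hT, hT3⟩ := Finset.exists_subset_card_eq (h3 i hi j hj hij)
    exact ⟨T, hT3, fun k hk => hall i hi k hk ▸ hT.trans Finset.inter_subset_left⟩
  push Not at hall
  obtain ⟨i, hi, j, hj, hij⟩ := hall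
  have hij' : i ≠ j := fun h => hij (h ▸ rfl)
  have hT : (N i ∩ N j).card = 3 := by
    refine le_antisymm ?_ (h3 i hi j hj hij')
    by_contra! hc
    have e1 := Finset.eq_of_subset_of_card_le (Finset.inter_subset_left : N i ∩ N j ⊆ N i)
      (by have := h4 i hi; omega)
    have e2 := Finset.eq_of_subset_of_card_le (Finset.inter_subset_right : N i ∩ N j ⊆ N j)
      (by have := h4 j hj; omega)
    exact hij (e1.symm.trans e2)
  by_cases hTall : ∀ k ∈ S, N i ∩ N j ⊆ N k
  · exact Or.inl ⟨_, hT, hTall⟩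
  push Not at hTall
  obtain ⟨k, hk, hTk⟩ := hTall
  have h4i := h4 i hi
  have h4j := h4 j hj
  have hun := Finset.card_union_add_card_inter (N i) (N j)
  -- a member missing part of the triple contains both remaining elements
  have outside : ∀ l ∈ S, ¬ N i ∩ N j ⊆ N l →
      (N l ∩ (N i ∩ N j)).card = 2 ∧ (N i).card = 4 ∧ (N j).card = 4 ∧
        4 ≤ (N l ∩ (N i ∪ N j)).card := by
    intro l hl hTl
    have hli : l ≠ i := by rintro rfl; exact hTl Finset.inter_subset_left
    have hlj : l ≠ j := by rintro rfl; exact hTl Finset.inter_subset_right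
    have a1 := h3 l hl i hi hli
    have a2 := h3 l hl j hj hlj
    have b : (N l ∩ (N i ∩ N j)).card < 3 := by
      rw [← hT]
      refine Finset.card_lt_card ⟨Finset.inter_subset_right, fun h => hTl ?_⟩
      exact h.trans Finset.inter_subset_left
    have c := Finset.card_union_add_card_inter (N l ∩ N i) (N l ∩ N j)
    rw [← Finset.inter_union_distrib_left, ← Finset.inter_inter_distrib_left] at c
    have d := h4 l hl
    have e : (N l ∩ (N i ∪ N j)).card ≤ (N l).card := Finset.card_le_card Finset.inter_subset_left
    -- Used for m = i and m = j, where N m absorbs the triple T = N i ∩ N j. From |N l ∩ N m| ≥ 3,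
    -- |T| = 3 and |N l ∩ T| ≤ 2 it forces |N m| = 4 and |N l ∩ T| = 2.
    have f : ∀ m, (N l ∩ N m).card + (N i ∩ N j).card ≤
        (N m ∪ (N i ∩ N j)).card + (N l ∩ (N i ∩ N j)).card := by
      intro m
      have h := Finset.card_union_add_card_inter (N l ∩ N m) (N i ∩ N j)
      have h1 : (N l ∩ N m ∪ N i ∩ N j).card ≤ (N m ∪ (N i ∩ N j)).card :=
        Finset.card_le_card (Finset.union_subset_union_left Finset.inter_subset_right)
      have h2 : (N l ∩ N m ∩ (N i ∩ N j)).card ≤ (N l ∩ (N i ∩ N j)).card :=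
        Finset.card_le_card (Finset.inter_subset_inter_right Finset.inter_subset_left)
      omega
    have fi := f i
    have fj := f j
    rw [Finset.union_eq_left.2 Finset.inter_subset_left] at fi
    rw [Finset.union_eq_left.2 Finset.inter_subset_right] at fj
    omega
  obtain ⟨k2, ki, kj, -⟩ := outside k hk hTk
  -- The size is 4 + 4 - 3 = 5.
  refine Or.inr ⟨N i ∪ N j, by omega, fun l hl => ?_⟩
  by_cases hTl : N i ∩ N j ⊆ N l
  -- Otherwise N l meets N i ∪ N j only in the triple. As N k lies in that union, N k ∩ N l lies in
  -- N k ∩ (N i ∩ N j), which has only two elements.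
  · by_contra! hc
    have hNl : N l ∩ (N i ∪ N j) = N i ∩ N j := by
      refine (Finset.eq_of_subset_of_card_le (Finset.subset_inter hTl ?_) (by omega)).symm
      exact Finset.inter_subset_left.trans Finset.subset_union_left
    have hkl : k ≠ l := by rintro rfl; exact hTk hTl
    have a := h3 k hk l hl hkl
    have a' := (outside k hk hTk).2.2.2
    have hkX : N k ⊆ N i ∪ N j := by
      have : N k ∩ (N i ∪ N j) = N k :=
        Finset.eq_of_subset_of_card_le Finset.inter_subset_left (by have := h4 k hk; omega)
      rw [← this]; exact Finset.inter_subset_right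
    have : N k ∩ N l ⊆ N k ∩ (N i ∩ N j) := by
      rw [← hNl]
      intro x hx
      have hx' := Finset.mem_inter.1 hx
      exact Finset.mem_inter.2 ⟨hx'.1, Finset.mem_inter.2 ⟨hx'.2, hkX hx'.1⟩⟩
    have := Finset.card_le_card this
    omega
  · exact (outside l hl hTl).2.2.2

/-! ### Two vertices with at most two common neighbours -/

namespace SimpleGraph

variable {V : Type*}

lemma exists_embedsInEulerGenus_of_eulerGenus_le {G : SimpleGraph V} {g : ℕ}
    (h : G.eulerGenus ≤ g) : ∃ k ≤ g, G.EmbedsInEulerGenus k := by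
  by_contra! hc
  have : ((g + 1 : ℕ) : ℕ∞) ≤ G.eulerGenus := by
    refine le_iInf₂ fun k hk => ?_
    by_contra hlt
    exact hc k (by have := Nat.cast_lt.1 (not_le.1 hlt); omega) hk
  have := Nat.cast_le.1 (this.trans h)
  omega

lemma EmbedsInEulerGenus.card_edges_le {G : SimpleGraph V} {k : ℕ} (hG : G.EmbedsInEulerGenus k)
    (X Y : Finset V) (hXY : Disjoint X Y) (D : Finset (V × V)) (hD : 2 ≤ D.card)
    (hDXY : ∀ d ∈ D, d.1 ∈ X ∧ d.2 ∈ Y ∧ G.Adj d.1 d.2) :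
    D.card + 4 ≤ 2 * (X.card + Y.card) + 2 * k := by
  classical
  obtain ⟨M, hM, φ, hφ, hadj⟩ := hG
  let ψ : X ⊕ Y → V := Sum.elim Subtype.val Subtype.val
  have hψ : Function.Injective ψ := by
    refine Function.Injective.sumElim Subtype.val_injective Subtype.val_injective ?_
    rintro ⟨a, ha⟩ ⟨b, hb⟩ rfl
    exact Finset.disjoint_left.1 hXY ha hb
  let D' : Finset (X × Y) := Finset.univ.filter fun d => ((d.1 : V), (d.2 : V)) ∈ D
  have hcard : D'.card = D.card := by
    refine Finset.card_bij (fun d _ => ((d.1 : V), (d.2 : V))) (by simp [D']) ?_ ?_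
    · rintro ⟨a, b⟩ _ ⟨a', b'⟩ _ h
      obtain ⟨h1, h2⟩ := Prod.mk.inj h
      exact Prod.ext (Subtype.ext h1) (Subtype.ext h2)
    · intro d hd
      exact ⟨(⟨d.1, (hDXY d hd).1⟩, ⟨d.2, (hDXY d hd).2.1⟩), by simpa [D'] using hd, rfl⟩
  have := M.card_bipartite_edges_le (φ ∘ ψ) (hφ.comp hψ) D' (by omega) (fun d hd =>
    hadj _ _ (hDXY _ (Finset.mem_filter.1 hd).2).2.2)
  simp only [Fintype.card_coe, hM] at this
  omega

/-- Among `2g+3` vertices of degree at most 4 in one colour class of a bipartite graph of Euler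
genus at most `g`, two have at most two common neighbours. -/
theorem exists_commonNeighbors_encard_le_two [Finite V] (G : SimpleGraph V) (A B S : Set V)
    {g : ℕ} (hg : 1 ≤ g) (hG : G.eulerGenus ≤ g) (hAB : G.IsBipartition A B) (hSB : S ⊆ B)
    (h4 : ∀ v ∈ S, (G.neighborSet v).encard ≤ 4) (hS : 2 * g + 3 ≤ S.ncard) :
    ∃ u ∈ S, ∃ v ∈ S, u ≠ v ∧ (G.commonNeighbors u v).encard ≤ 2 := by
  classical
  have : Fintype V := Fintype.ofFinite V
  obtain ⟨k, hkg, hk⟩ := exists_embedsInEulerGenus_of_eulerGenus_le hG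
  by_contra! hc
  have hS' : S.ncard = S.toFinset.card := Set.ncard_eq_toFinset_card' S
  have hcom : ∀ u v, (G.commonNeighbors u v).encard =
      (G.neighborFinset u ∩ G.neighborFinset v).card := by
    intro u v
    rw [← Set.encard_coe_eq_coe_finsetCard]
    simp [commonNeighbors]
  have hSA : ∀ X : Finset V, (∀ x ∈ X, ∃ v ∈ S, G.Adj v x) → Disjoint X S.toFinset := by
    intro X hX
    rw [Finset.disjoint_left]
    intro x hx hxS
    obtain ⟨v, hv, hvx⟩ := hX x hx
    have := hAB.1.mem_of_mem_adj' (hSB hv) hvx.symm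
    exact Set.disjoint_left.1 hAB.1.disjoint this (hSB (by simpa using hxS))
  have bound : ∀ (X : Finset V) (m : ℕ), 1 ≤ m → (∀ x ∈ X, ∃ v ∈ S, G.Adj v x) →
      (∀ v ∈ S, m ≤ (G.neighborFinset v ∩ X).card) →
      m * S.toFinset.card + 4 ≤ 2 * (X.card + S.toFinset.card) + 2 * k := by
    intro X m hm hX hmX
    let D := (X ×ˢ S.toFinset).filter fun d => G.Adj d.1 d.2
    have hDc : m * S.toFinset.card ≤ D.card := by
      have hf : D.card = ∑ v ∈ S.toFinset, (D.filter fun d => d.2 = v).card :=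
        Finset.card_eq_sum_card_fiberwise (fun d hd => by
          have := Finset.mem_filter.1 hd
          exact (Finset.mem_product.1 this.1).2)
      rw [hf, mul_comm, ← smul_eq_mul, ← Finset.sum_const]
      refine Finset.sum_le_sum fun v hv => (hmX v (by simpa using hv)).trans ?_
      refine Finset.card_le_card_of_injOn (fun x => (x, v)) (fun x hx => ?_) (fun x _ y _ h => ?_)
      · simp only [Finset.coe_inter, Set.mem_inter_iff, Finset.mem_coe, mem_neighborFinset] at hx
        simpa [D, hx.2, G.adj_comm x v, hx.1] using hv
      · exact congrArg Prod.fst h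
    have h2 : 2 ≤ D.card := by nlinarith
    have := hk.card_edges_le X S.toFinset (hSA X hX) D h2 (fun d hd => by
      simpa [D, and_assoc] using hd)
    omega
  have hN4 : ∀ v ∈ S.toFinset, (G.neighborFinset v).card ≤ 4 := by
    intro v hv
    have := h4 v (by simpa using hv)
    rw [← coe_neighborFinset, Set.encard_coe_eq_coe_finsetCard] at this
    exact_mod_cast this
  have hN3 : ∀ u ∈ S.toFinset, ∀ v ∈ S.toFinset, u ≠ v →
      3 ≤ (G.neighborFinset u ∩ G.neighborFinset v).card := by
    intro u hu v hv huv
    have := hc u (by simpa using hu) v (by simpa using hv) huv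
    rw [hcom] at this
    exact_mod_cast Order.add_one_le_of_lt this
  rcases exists_triple_or_exists_quintuple S.toFinset (by omega) _ hN4 hN3 with
    ⟨T, hT, hTS⟩ | ⟨X, hX, hXS⟩
  -- With n = |S|, the bound 3n + 4 ≤ 2(3 + n) + 2k gives n ≤ 2k + 2.
  · obtain ⟨v, hv⟩ : S.toFinset.Nonempty := Finset.card_pos.1 (by omega)
    have := bound T 3 (by omega)
      (fun x hx => ⟨v, by simpa using hv, by simpa using hTS v hv hx⟩)
      (fun v hv => by rw [Finset.inter_eq_right.2 (hTS v (by simpa using hv)), hT])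
    omega
  -- Discarding the elements of `X` with no neighbour in `S` makes it disjoint from `S`. Then 4n + 4
  -- ≤ 2(5 + n) + 2k gives n ≤ k + 3, which is less than 2g + 3 because g ≥ 1.
  · let X' := X.filter fun x => ∃ v ∈ S, G.Adj v x
    have hX' : X'.card ≤ 5 := (Finset.card_filter_le _ _).trans hX
    have := bound X' 4 (by omega) (fun x hx => (Finset.mem_filter.1 hx).2)
      (fun v hv => (hXS v (by simpa using hv)).trans (Finset.card_le_card fun x hx => by
        simp only [Finset.mem_inter, mem_neighborFinset] at hx
        simp only [Finset.mem_inter, mem_neighborFinset, X', Finset.mem_filter]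
        exact ⟨hx.1, hx.2, v, hv, hx.1⟩))
    omega

end SimpleGraph

/-! ### Cubic graphs with three pairwise Hamiltonian matchings -/

/-- Three perfect matchings on `B`, any two of which form a Hamiltonian cycle. -/
structure PerfectTriple (B : Type) where
  /-- the matchings -/
  m : Fin 3 → B → B
  invol : ∀ c, Function.Involutive (m c)
  ne : ∀ c b, m c b ≠ b
  hamiltonian : ∀ c d, c ≠ d → ∀ f : B → Prop, (∀ b, f (m c b) ↔ f b) →
    (∀ b, f (m d b) ↔ f b) → ∀ b b', f b → f b'

namespace PerfectTriple

/-- Three parallel edges. -/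
def theta : PerfectTriple Bool where
  m _ b := !b
  invol _ := Bool.not_not
  ne _ := Bool.not_ne_self
  hamiltonian c d _ f h _ b b' hb := by
    have := h b
    cases b <;> cases b' <;> simp_all

variable {B : Type} [DecidableEq B]

/-- Extend an involution `m` of `B` to two new points `q`, `!q`, so that `v` is matched with `q`
and `!q` with the former partner of `v`. -/
def extend (m : B → B) (v : B) (q : Bool) : B ⊕ Bool → B ⊕ Bool
  | Sum.inl b => if b = v then Sum.inr q else if b = m v then Sum.inr !q else Sum.inl (m b)
  | Sum.inr r => if r = q then Sum.inl v else Sum.inl (m v)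

lemma extend_involutive {m : B → B} (hm : Function.Involutive m) (hne : ∀ b, m b ≠ b) (v : B)
    (q : Bool) : Function.Involutive (extend m v q) := by
  rintro (b | r)
  · by_cases h1 : b = v
    · simp [extend, h1]
    by_cases h2 : b = m v
    · simp [extend, h2, hne]
    · have h3 : m b ≠ v := fun h => h2 (by rw [← h, hm])
      have h4 : m b ≠ m v := fun h => h1 (hm.injective h)
      simp [extend, h1, h2, h3, h4, hm b]
  · by_cases h1 : r = q
    · simp [extend, h1]
    · have : r = !q := by cases r <;> cases q <;> simp_all
      simp [extend, hne, this]

lemma extend_ne {m : B → B} (hne : ∀ b, m b ≠ b) (v : B) (q : Bool) (x : B ⊕ Bool) :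
    extend m v q x ≠ x := by
  rcases x with b | r
  · simp only [extend]
    split_ifs <;> simp [hne]
  · simp only [extend]
    split_ifs <;> simp

lemma iff_of_extend {m : B → B} (hne : ∀ b, m b ≠ b) {v : B}
    {q : Bool} {f : B ⊕ Bool → Prop} (hf : ∀ x, f (extend m v q x) ↔ f x) :
    (f (Sum.inr q) ↔ f (Sum.inl v)) ∧ (f (Sum.inr !q) ↔ f (Sum.inl (m v))) ∧
      ∀ b, b ≠ v → b ≠ m v → (f (Sum.inl (m b)) ↔ f (Sum.inl b)) := by
  refine ⟨?_, ?_, fun b h1 h2 => ?_⟩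
  · simpa [extend] using hf (Sum.inl v)
  · simpa [extend, hne] using hf (Sum.inl (m v))
  · simpa [extend, h1, h2] using hf (Sum.inl b)

/-- Once `f` agrees on the two new points, the path from `v` through them to `m v` acts as the old
matching edge, so invariance descends to `B`. -/
lemma iff_of_extend_of_iff {m : B → B} (hm : Function.Involutive m) (hne : ∀ b, m b ≠ b) {v : B}
    {q : Bool} {f : B ⊕ Bool → Prop} (hf : ∀ x, f (extend m v q x) ↔ f x)
    (hr : f (Sum.inr !q) ↔ f (Sum.inr q)) (b : B) : f (Sum.inl (m b)) ↔ f (Sum.inl b) := by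
  obtain ⟨h1, h2, h3⟩ := iff_of_extend hne hf
  by_cases e1 : b = v
  · subst e1; tauto
  by_cases e2 : b = m v
  · subst e2; rw [hm]; tauto
  · exact h3 b e1 e2

/-- Replace the vertex `v` by a triangle. -/
def truncate (T : PerfectTriple B) (v : B) : PerfectTriple (B ⊕ Bool) where
  -- The triangle is `v`, `true`, `false`: its side `true`-`false` has colour 0, `v`-`true` colour 1
  -- and `v`-`false` colour 2. The old edges of colours 0, 1, 2 at `v` now end at `v`, `false`,
  -- `true` respectively.
  m := ![Sum.map (T.m 0) not, extend (T.m 1) v true, extend (T.m 2) v false]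
  invol c := by
    fin_cases c
    · rintro (b | r)
      · simp [T.invol 0 b]
      · simp
    · exact extend_involutive (T.invol 1) (T.ne 1) v true
    · exact extend_involutive (T.invol 2) (T.ne 2) v false
  ne c := by
    fin_cases c
    · rintro (b | r)
      · simp [T.ne 0 b]
      · simp
    · exact extend_ne (T.ne 1) v true
    · exact extend_ne (T.ne 2) v false
  hamiltonian := by
    intro c d hcd f hc hd
    -- It suffices that `f` agrees on the whole triangle and is invariant on `B`, where the old
    -- Hamiltonian cycle applies.
    have hinl : ∀ (c d : Fin 3), c ≠ d → (∀ b, f (Sum.inl (T.m c b)) ↔ f (Sum.inl b)) →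
        (∀ b, f (Sum.inl (T.m d b)) ↔ f (Sum.inl b)) →
        (f (Sum.inr true) ↔ f (Sum.inl v)) → (f (Sum.inr false) ↔ f (Sum.inl v)) →
        ∀ x y, f x → f y := by
      intro c d hcd h1 h2 ht hf
      have key := T.hamiltonian c d hcd (fun b => f (Sum.inl b)) h1 h2
      have hv : ∀ x, f x ↔ f (Sum.inl v) := by
        rintro (b | _ | _)
        · exact ⟨key _ _, key _ _⟩
        · exact hf
        · exact ht
      intro x y hx
      rwa [hv, ← hv x]
    have h01 : (∀ x, f (Sum.map (T.m 0) not x) ↔ f x) → (∀ x, f (extend (T.m 1) v true x) ↔ f x) →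
        ∀ x y, f x → f y := by
      intro h0 h1
      have a : f (Sum.inr false) ↔ f (Sum.inr true) := by simpa using h0 (Sum.inr true)
      have b := (iff_of_extend (T.ne 1) h1).1
      exact hinl 0 1 (by decide) (fun b => by simpa using h0 (Sum.inl b))
        (iff_of_extend_of_iff (T.invol 1) (T.ne 1) h1 a) b (a.trans b)
    have h02 : (∀ x, f (Sum.map (T.m 0) not x) ↔ f x) → (∀ x, f (extend (T.m 2) v false x) ↔ f x) →
        ∀ x y, f x → f y := by
      intro h0 h1
      have a : f (Sum.inr true) ↔ f (Sum.inr false) := by simpa using h0 (Sum.inr false)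
      have b := (iff_of_extend (T.ne 2) h1).1
      exact hinl 0 2 (by decide) (fun b => by simpa using h0 (Sum.inl b))
        (iff_of_extend_of_iff (T.invol 2) (T.ne 2) h1 a) (a.trans b) b
    have h12 : (∀ x, f (extend (T.m 1) v true x) ↔ f x) →
        (∀ x, f (extend (T.m 2) v false x) ↔ f x) → ∀ x y, f x → f y := by
      intro h1 h2
      have a := (iff_of_extend (T.ne 1) h1).1
      have b := (iff_of_extend (T.ne 2) h2).1
      exact hinl 1 2 (by decide) (iff_of_extend_of_iff (T.invol 1) (T.ne 1) h1 (b.trans a.symm))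
        (iff_of_extend_of_iff (T.invol 2) (T.ne 2) h2 (a.trans b.symm)) a b
    fin_cases c <;> fin_cases d
    · exact absurd rfl hcd
    · exact h01 hc hd
    · exact h02 hc hd
    · exact h01 hd hc
    · exact absurd rfl hcd
    · exact h12 hc hd
    · exact h02 hd hc
    · exact h12 hd hc
    · exact absurd rfl hcd

lemma exists_card_eq (g : ℕ) : ∃ B : Type, Finite B ∧ Nat.card B = 2 * g + 2 ∧
    Nonempty (PerfectTriple B) := by
  classical
  induction g with
  | zero => exact ⟨Bool, inferInstance, by simp, ⟨theta⟩⟩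
  | succ g ih =>
    obtain ⟨B, hB, hc, ⟨T⟩⟩ := ih
    have : Nonempty B := (Nat.card_pos_iff.1 (by omega)).1
    exact ⟨B ⊕ Bool, inferInstance, by rw [Nat.card_sum, hc]; simp; omega,
      ⟨T.truncate (Classical.arbitrary B)⟩⟩

end PerfectTriple

/-! ### The quadrangulation from three matchings -/

open Equiv

/-- The two transpositions generate the symmetric group. Right multiplication by them is how `t1`
(at an end in `B`) and `t2` act on the permutation of a flag of `PerfectTriple.surface`. -/
lemma Equiv.Perm.fin_three_induction {f : Perm (Fin 3) → Prop}
    (h01 : ∀ σ, f (σ * swap 0 1) ↔ f σ) (h12 : ∀ σ, f (σ * swap 1 2) ↔ f σ) (σ τ : Perm (Fin 3)) :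
    f σ ↔ f τ := by
  have h : ∀ σ τ : Perm (Fin 3), τ = σ ∨ τ = σ * swap 0 1 ∨ τ = σ * swap 1 2 ∨
      τ = σ * swap 0 1 * swap 1 2 ∨ τ = σ * swap 1 2 * swap 0 1 ∨
      τ = σ * swap 0 1 * swap 1 2 * swap 0 1 := by decide
  rcases h σ τ with rfl | rfl | rfl | rfl | rfl | rfl <;> simp [h01, h12]

namespace PerfectTriple

variable {B : Type} (T : PerfectTriple B)

/-- The quadrangulation whose 1-skeleton is complete bipartite between `Fin 3` and `B`.  The flag
`(b, σ, ε)` lies on the edge `σ 0 - b`, at its end `b` if `ε` is true, and on the quadrangle with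
vertices `σ 0`, `b`, `σ 1` and the partner of `b` in the matching `σ 2`. -/
def surface [Finite B] [Nonempty B] : CellSurface where
  Flag := B × Perm (Fin 3) × Bool
  finite_flag := inferInstance
  nonempty_flag := inferInstance
  t0 x := (x.1, x.2.1, !x.2.2)
  -- Within the quadrangle, turning at `b` exchanges `σ 0` and `σ 1`, while turning at `σ 0`
  -- exchanges `b` with its `σ 2`-partner.
  t1 x := if x.2.2 then (x.1, x.2.1 * swap 0 1, true) else (T.m (x.2.1 2) x.1, x.2.1, false)
  t2 x := (x.1, x.2.1 * swap 1 2, x.2.2)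
  t0_invol x := by simp
  t1_invol := by rintro ⟨b, σ, _ | _⟩ <;> simp [T.invol _ b, mul_assoc]
  t2_invol x := by simp [mul_assoc]
  t0_ne x h := by simpa using congrArg (fun y => y.2.2) h
  t1_ne := by
    rintro ⟨b, σ, _ | _⟩ h
    · exact T.ne _ _ (congrArg Prod.fst h)
    · have h' : σ * swap 0 1 = σ := congrArg (fun y => y.2.1) h
      exact absurd (mul_eq_left.1 h') (by decide)
  t2_ne x h := by
    have h' : x.2.1 * swap 1 2 = x.2.1 := congrArg (fun y => y.2.1) h
    exact absurd (mul_eq_left.1 h') (by decide)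
  t0_t2 x := rfl
  t0_t2_ne x h := by simpa using congrArg (fun y => y.2.2) h
  connected := by
    intro x y
    set r : B × Perm (Fin 3) × Bool → B × Perm (Fin 3) × Bool → Prop := fun a b => _
    have hr : ∀ {a b}, r a b → (Relation.EqvGen r x a ↔ Relation.EqvGen r x b) := fun h =>
      ⟨fun h' => h'.trans _ _ _ (.rel _ _ h), fun h' => h'.trans _ _ _ (.symm _ _ (.rel _ _ h))⟩
    have hε : ∀ b σ ε ε', Relation.EqvGen r x (b, σ, ε) ↔ Relation.EqvGen r x (b, σ, ε') := by
      have h : ∀ b σ, Relation.EqvGen r x (b, σ, true) ↔ Relation.EqvGen r x (b, σ, false) :=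
        fun b σ => hr (Or.inl rfl)
      rintro b σ (_ | _) (_ | _) <;> simp [h]
    have hσ : ∀ b σ τ ε, Relation.EqvGen r x (b, σ, ε) ↔ Relation.EqvGen r x (b, τ, ε) := by
      intro b σ τ ε
      rw [hε b σ ε true, hε b τ ε true]
      refine Perm.fin_three_induction (f := fun σ => Relation.EqvGen r x (b, σ, true))
        (fun σ => (hr (Or.inr (Or.inl ?_))).symm) (fun σ => (hr (Or.inr (Or.inr ?_))).symm) σ τ
      · simp
      · simp
    have hb : ∀ c b, Relation.EqvGen r x (T.m c b, 1, false) ↔ Relation.EqvGen r x (b, 1, false) := by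
      intro c b
      rw [hσ (T.m c b) 1 (swap 2 c), hσ b 1 (swap 2 c)]
      refine (hr (Or.inr (Or.inl ?_))).symm
      simp
    have h := T.hamiltonian 0 1 (by decide) (fun b => Relation.EqvGen r x (b, 1, false)) (hb 0)
      (hb 1) x.1 y.1 ((hσ _ _ _ _).1 ((hε _ _ _ _).1 (.refl x)))
    exact (hε _ _ _ _).1 ((hσ _ _ _ _).1 h)

section

variable [Finite B] [Nonempty B]

/-- The vertex of the complete bipartite graph at which a flag lies. -/
def label : T.surface.Vertex → Fin 3 ⊕ B :=
  Quot.lift (fun x : B × Perm (Fin 3) × Bool => if x.2.2 then Sum.inr x.1 else Sum.inl (x.2.1 0))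
    (by
      rintro ⟨b, σ, _ | _⟩ y (rfl | rfl)
      · simp [surface]
      · simp [surface, swap_apply_of_ne_of_ne]
      · simp [surface]
      · simp [surface])

/-- The vertices of the quadrangulation. -/
noncomputable def vertex : Fin 3 ⊕ B → T.surface.Vertex
  | Sum.inl a => T.surface.vertexOf (Classical.arbitrary B, swap 0 a, false)
  | Sum.inr b => T.surface.vertexOf (b, 1, true)

lemma vertex_injective : Function.Injective T.vertex := by
  have : Function.LeftInverse T.label T.vertex := by
    rintro (a | b)
    · change Sum.inl (swap 0 a 0) = Sum.inl a
      simp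
    · rfl
  exact this.injective

lemma vertexOf_true (b : B) (σ : Perm (Fin 3)) :
    T.surface.vertexOf (b, σ, true) = T.vertex (Sum.inr b) :=
  (Perm.fin_three_induction (f := fun σ => T.surface.vertexOf (b, σ, true) = T.vertex (Sum.inr b))
    (fun σ => by rw [← T.surface.vertexOf_t1 (b, σ, true)]; rfl)
    (fun σ => by rw [← T.surface.vertexOf_t2 (b, σ, true)]; rfl) σ 1).2 rfl

/-- Turning around `a` applies alternately the matchings of the other two colours. Their union is a
Hamiltonian cycle, so all these flags lie at one vertex. -/
lemma vertexOf_false (b : B) (a : Fin 3) :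
    T.surface.vertexOf (b, swap 0 a, false) = T.vertex (Sum.inl a) := by
  set σ := swap 0 a
  have h2 : ∀ b (τ : Perm (Fin 3)), T.surface.vertexOf (T.m (τ 2) b, τ, false) =
      T.surface.vertexOf (b, τ, false) := fun b τ => T.surface.vertexOf_t1 (b, τ, false)
  have hs : ∀ b (τ : Perm (Fin 3)), T.surface.vertexOf (b, τ * swap 1 2, false) =
      T.surface.vertexOf (b, τ, false) := fun b τ => T.surface.vertexOf_t2 (b, τ, false)
  refine T.hamiltonian (σ 2) (σ 1) (by simp) (fun b => T.surface.vertexOf (b, σ, false) =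
    T.vertex (Sum.inl a)) (fun b => by rw [h2]) (fun b => ?_) (Classical.arbitrary B) b rfl
  have h3 := h2 b (σ * swap 1 2)
  rw [hs, hs] at h3
  simp only [Perm.mul_apply, swap_apply_right] at h3
  rw [h3]

lemma joined_vertex (a : Fin 3) (b : B) :
    T.surface.Joined (T.vertex (Sum.inl a)) (T.vertex (Sum.inr b)) :=
  ⟨(b, swap 0 a, false), T.vertexOf_false b a, T.vertexOf_true b _⟩

lemma card_edge_le : Nat.card T.surface.Edge ≤ 3 * Nat.card B := by
  have hsurj : Function.Surjective
      fun p : Fin 3 × B => T.surface.edgeOf (p.2, swap 0 p.1, false) := by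
    intro e
    obtain ⟨⟨b, σ, ε⟩, rfl⟩ := T.surface.edgeOf_surj e
    refine ⟨(σ 0, b), ?_⟩
    have h0 : ∀ (τ : Perm (Fin 3)), T.surface.edgeOf (b, τ, true) =
      T.surface.edgeOf (b, τ, false) := fun τ => T.surface.edgeOf_t0 (b, τ, false)
    have hs : ∀ (τ : Perm (Fin 3)), T.surface.edgeOf (b, τ * swap 1 2, false) =
      T.surface.edgeOf (b, τ, false) := fun τ => T.surface.edgeOf_t2 (b, τ, false)
    have hτ : ∀ σ : Perm (Fin 3), swap 0 (σ 0) = σ ∨ swap 0 (σ 0) = σ * swap 1 2 := by decide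
    have : T.surface.edgeOf (b, σ, ε) = T.surface.edgeOf (b, σ, false) := by
      cases ε <;> simp [h0]
    rw [this]
    rcases hτ σ with h | h
    · simp only [h]
    · simp only [h, hs]
  simpa using Nat.card_le_card_of_surjective _ hsurj

/-- Each face has at most eight flags. -/
lemma twelve_mul_card_le : 12 * Nat.card B ≤ 8 * Nat.card T.surface.Face := by
  classical
  have : Fintype B := Fintype.ofFinite B
  have : Fintype T.surface.Face := Fintype.ofFinite _
  have hfib : ∀ f ∈ (Finset.univ : Finset T.surface.Face),
      (Finset.univ.filter fun x : B × Perm (Fin 3) × Bool => T.surface.faceOf x = f).card ≤ 8 := by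
    intro f _
    obtain ⟨⟨b, σ, ε⟩, rfl⟩ := T.surface.faceOf_surj f
    let F : Finset (B × Perm (Fin 3) × Bool) :=
      {b, T.m (σ 2) b} ×ˢ {σ, σ * swap 0 1} ×ˢ Finset.univ
    have hF : F.card ≤ 8 := by
      have h1 : ({b, T.m (σ 2) b} : Finset B).card ≤ 2 := Finset.card_le_two
      have h2 : ({σ, σ * swap 0 1} : Finset (Perm (Fin 3))).card ≤ 2 := Finset.card_le_two
      rw [Finset.card_product, Finset.card_product, Finset.card_univ, Fintype.card_bool]
      nlinarith
    refine (Finset.card_le_card fun x hx => ?_).trans hF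
    -- `F` is closed under `t0` and `t1`, hence contains the whole face of the flag (b, σ, ε).
    have hinv : ∀ x y, Relation.EqvGen
        (fun x y : T.surface.Flag => y = T.surface.t0 x ∨ y = T.surface.t1 x) x y →
        (x ∈ F ↔ y ∈ F) := by
      intro x y h
      induction h with
      | rel x y h =>
        obtain ⟨b', τ, δ⟩ := x
        have hσ2 : ∀ τ, (τ = σ ∨ τ = σ * swap 0 1) → τ 2 = σ 2 := by
          rintro τ (rfl | rfl)
          · rfl
          · simp [swap_apply_of_ne_of_ne]
        rcases h with rfl | rfl
        · simp [F, surface]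
        · cases δ
          · simp only [F, surface, Finset.mem_product, Finset.mem_insert, Finset.mem_singleton,
              Finset.mem_univ, and_true]
            simp only [Bool.false_eq_true, if_false]
            refine and_congr_left fun hτ => ?_
            rw [hσ2 τ hτ, (T.invol (σ 2)).injective.eq_iff, (T.invol (σ 2)).eq_iff, or_comm]
          · simp only [F, surface, Finset.mem_product, Finset.mem_insert, Finset.mem_singleton,
              Finset.mem_univ, and_true]
            simp only [if_true]
            refine and_congr_right fun _ => ?_
            rw [mul_left_inj, or_comm, ← eq_mul_inv_iff_mul_eq, swap_inv]
      | refl => rfl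
      | symm _ _ _ ih => exact ih.symm
      | trans _ _ _ _ _ ih ih' => exact ih.trans ih'
    refine (hinv _ _ (Quot.eqvGen_exact (Finset.mem_filter.1 hx).2)).2 ?_
    exact Finset.mem_product.2 ⟨by simp, Finset.mem_product.2 ⟨by simp, by simp⟩⟩
  have hle : Fintype.card (B × Perm (Fin 3) × Bool) ≤ 8 * Fintype.card T.surface.Face :=
    Finset.card_le_mul_card_image_of_maps_to
    (s := (Finset.univ : Finset (B × Perm (Fin 3) × Bool))) (f := fun x => T.surface.faceOf x)
    (fun _ _ => Finset.mem_univ _) 8 hfib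
  rw [Fintype.card_prod, Fintype.card_prod, Fintype.card_perm, Fintype.card_fin,
    Fintype.card_bool] at hle
  simp only [Nat.factorial] at hle
  simp only [Nat.card_eq_fintype_card]
  omega

/-- With n = |B|, the one-sided counts V ≥ 3 + n, E ≤ 3n and F ≥ 3n/2 give χ ≥ 3 - n/2. -/
lemma eulerGenus_surface_le : 2 * T.surface.eulerGenus ≤ Nat.card B - 2 := by
  have hV : 3 + Nat.card B ≤ Nat.card T.surface.Vertex := by
    simpa using Nat.card_le_card_of_injective _ T.vertex_injective
  have hE := T.card_edge_le
  have hF := T.twelve_mul_card_le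
  rw [CellSurface.eulerGenus, CellSurface.eulerChar]
  omega

end

end PerfectTriple

/-! ### The Euler genus of K_{3,2g+2} -/

namespace SimpleGraph

theorem eulerGenus_completeBipartiteGraph (g : ℕ) :
    (completeBipartiteGraph (Fin 3) (Fin (2 * g + 2))).eulerGenus = g := by
  classical
  apply le_antisymm
  · obtain ⟨B, hB, hc, ⟨T⟩⟩ := PerfectTriple.exists_card_eq g
    have : Nonempty B := (Nat.card_pos_iff.1 (by omega)).1
    let e : Fin (2 * g + 2) ≃ B := (finCongr hc.symm).trans (Finite.equivFin B).symm
    let φ := T.vertex ∘ Sum.map id e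
    have hφ : Function.Injective φ :=
      T.vertex_injective.comp (Sum.map_injective.2 ⟨Function.injective_id, e.injective⟩)
    have hle := T.eulerGenus_surface_le
    -- `EmbedsInEulerGenus` asks for a surface of genus exactly g. The quadrangulation count gives
    -- at most g; the edge bound on the same surface gives at least g.
    have hge := T.surface.card_bipartite_edges_le φ hφ Finset.univ (by simp; omega)
      (fun d _ => T.joined_vertex d.1 (e d.2))
    simp only [Finset.card_univ, Fintype.card_prod, Fintype.card_fin] at hge
    refine iInf₂_le g ⟨T.surface, by push_cast at hge; omega, φ, hφ, ?_⟩
    rintro (a | b) (a' | b') h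
    · simp at h
    · exact T.joined_vertex a (e b')
    · exact (T.joined_vertex a' (e b)).symm
    · simp at h
  · refine le_iInf₂ fun k hk => ?_
    obtain ⟨M, hM, φ, hφ, hadj⟩ := hk
    -- The bound reads 3(2g + 2) ≤ 2(3 + 2g + 2) - 4 + 2k, that is, g ≤ k.
    have hge := M.card_bipartite_edges_le φ hφ Finset.univ (by simp; omega)
      (fun d _ => hadj _ _ (by simp))
    simp only [Finset.card_univ, Fintype.card_prod, Fintype.card_fin] at hge
    push_cast at hge
    exact_mod_cast (by omega : g ≤ k)

lemma commonNeighbors_completeBipartiteGraph_inr {α β : Type*} (i j : β) :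
    (completeBipartiteGraph α β).commonNeighbors (Sum.inr i) (Sum.inr j) = Set.range Sum.inl := by
  ext (a | b) <;> simp [commonNeighbors]

/-! ### Ordered pairs and the value of the extremal number -/

variable {V : Type*}

lemma IsBipartition.closedNbhd_inter {G : SimpleGraph V} {A B : Set V} (h : G.IsBipartition A B)
    {u v : V} (hu : u ∈ B) (hv : v ∈ B) (huv : u ≠ v) :
    G.closedNbhd u ∩ G.closedNbhd v = G.commonNeighbors u v := by
  have hn : ∀ {x y}, x ∈ B → y ∈ B → ¬ G.Adj x y := fun hx hy hxy =>
    Set.disjoint_left.1 h.1.disjoint (h.1.mem_of_mem_adj' hy hxy) hx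
  ext w
  simp only [closedNbhd, commonNeighbors, Set.mem_inter_iff, Set.mem_union, mem_neighborSet,
    Set.mem_singleton_iff]
  constructor
  · rintro ⟨h1 | rfl, h2 | rfl⟩
    · exact ⟨h1, h2⟩
    · exact absurd h1 (hn hu hv)
    · exact absurd h2 (hn hv hu)
    · exact absurd rfl huv
  · exact fun h => ⟨Or.inl h.1, Or.inl h.2⟩

lemma isOrderedSeq_two_iff {G : SimpleGraph V} (v : Fin 2 → V) :
    G.IsOrderedSeq v ↔
      v 0 ≠ v 1 ∧ (G.closedNbhd (v 0) ∩ G.closedNbhd (v 1)).encard ≤ 2 := by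
  have h1 : (⋃ j : Fin 2, ⋃ _ : j < 1, G.closedNbhd (v j)) = G.closedNbhd (v 0) := by
    ext w; simp
  have h0 : (⋃ j : Fin 2, ⋃ _ : j < 0, G.closedNbhd (v j)) = ∅ := by
    ext w; simp
  have hinj : Function.Injective v ↔ v 0 ≠ v 1 := by
    constructor
    · exact fun h h' => absurd (h h') (by decide)
    · intro h i j hij
      fin_cases i <;> fin_cases j
      · rfl
      · exact absurd hij h
      · exact absurd hij.symm h
      · rfl
  rw [IsOrderedSeq, hinj, Fin.forall_fin_two, h1, h0, Set.inter_comm (G.closedNbhd (v 1))]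
  simp

end SimpleGraph

lemma forcesOrderedSeq_two {g b : ℕ} (hg : 1 ≤ g) (hb : 2 * g + 2 ≤ b) :
    ForcesOrderedSeq g 2 b := by
  intro V _ G A B hG hAB hB h4
  obtain ⟨u, hu, v, hv, huv, h⟩ :=
    G.exists_commonNeighbors_encard_le_two A B B hg hG hAB le_rfl h4 (by omega)
  refine ⟨![u, v], by simp [Fin.forall_fin_two, hu, hv], ?_⟩
  rw [SimpleGraph.isOrderedSeq_two_iff]
  exact ⟨huv, by simpa [hAB.closedNbhd_inter hu hv huv] using h⟩

/-- K_{3,2g+2} is the obstruction: a smaller `b` would force two vertices of its large class to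
share at most two of their three common neighbours. -/
lemma le_of_forcesOrderedSeq_two {g b : ℕ} (h : ForcesOrderedSeq g 2 b) : 2 * g + 2 ≤ b := by
  by_contra! hb
  have hbip : (completeBipartiteGraph (Fin 3) (Fin (2 * g + 2))).IsBipartition
      (Set.range Sum.inl) (Set.range Sum.inr) := by
    refine ⟨⟨Set.isCompl_range_inl_range_inr.disjoint, ?_⟩, Set.range_inl_union_range_inr⟩
    rintro (a | a) (b | b) h <;> simp_all
  obtain ⟨v, hvB, hv⟩ := h _ _ _ _ (SimpleGraph.eulerGenus_completeBipartiteGraph g).le hbip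
    (by rw [← Set.image_univ, Set.ncard_image_of_injective _ Sum.inr_injective,
          Set.ncard_univ]; simpa using hb)
    (by
      rintro _ ⟨i, rfl⟩
      refine (Set.encard_le_encard (t := Set.range Sum.inl) ?_).trans ?_
      · rintro (a | a) h <;> simp_all
      · rw [← Set.image_univ, Sum.inl_injective.encard_image]
        simp; norm_num)
  rw [SimpleGraph.isOrderedSeq_two_iff] at hv
  obtain ⟨hne, hle⟩ := hv
  rw [hbip.closedNbhd_inter (hvB 0) (hvB 1) hne] at hle
  obtain ⟨i, hi⟩ := hvB 0
  obtain ⟨j, hj⟩ := hvB 1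
  rw [← hi, ← hj, SimpleGraph.commonNeighbors_completeBipartiteGraph_inr, ← Set.image_univ,
    Sum.inl_injective.encard_image] at hle
  norm_num at hle

theorem lemma7 (g : ℕ) (hg : 1 ≤ g) :
    (IsLeast {b : ℕ | ForcesOrderedSeq g 2 b} (orderedNumber g 2) ∧
      orderedNumber g 2 = 2 * g + 2) ∧
    (∀ (V : Type*) [Finite V] (G : SimpleGraph V) (A B S : Set V),
      G.eulerGenus ≤ g → G.IsBipartition A B → S ⊆ B →
      (∀ v ∈ S, (G.neighborSet v).encard ≤ 4) → 2 * g + 3 ≤ S.ncard →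
      ∃ u ∈ S, ∃ v ∈ S, u ≠ v ∧ (G.commonNeighbors u v).encard ≤ 2) ∧
    ((completeBipartiteGraph (Fin 3) (Fin (2 * g + 2))).eulerGenus = g ∧
      ∀ i j : Fin (2 * g + 2), i ≠ j →
        ((completeBipartiteGraph (Fin 3) (Fin (2 * g + 2))).commonNeighbors
          (Sum.inr i) (Sum.inr j)).encard = 3) := by
  have hleast : IsLeast {b : ℕ | ForcesOrderedSeq g 2 b} (2 * g + 2) :=
    ⟨forcesOrderedSeq_two hg le_rfl, fun _ h => le_of_forcesOrderedSeq_two h⟩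
  have heq : orderedNumber g 2 = 2 * g + 2 := hleast.csInf_eq
  refine ⟨⟨heq ▸ hleast, heq⟩, ?_, SimpleGraph.eulerGenus_completeBipartiteGraph g, ?_⟩
  · intro V _ G A B S hG hAB hSB h4 hS
    exact G.exists_commonNeighbors_encard_le_two A B S hg hG hAB hSB h4 hS
  · intro i j _
    rw [SimpleGraph.commonNeighbors_completeBipartiteGraph_inr, ← Set.image_univ,
      Sum.inl_injective.encard_image]
    simp
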